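/- Let $G$ and $H$ be countable groups with normal subgroups $M\lhd G$ and $N\lhd H$. Let $G\curvearrowright (X,\mu)$ be a Borel probability measure preserving action on a standard probability space, and let $H\curvearrowright Z$ be a smooth Borel action, i.e. a Borel action on a countably separated (for instance, standard) Borel space $Z$ whose orbit space $Z/H$, with the quotient Borel structure, is countably separated. An ME-coupling of $G$ and $H$ is a standard Borel space $\Omega$ with a nonzero measure $m$ and commuting Borel $m$-preserving actions of $G$ and $H$, each of which admits a measurable fundamental domain of finite measure (fundamental domains are understood up to null sets). Assume that: 1. $c:G\times X\to H$ is an ME-cocycle, i.e. there is an ME-coupling $(\Omega,m)$ of $G$ and $H$ such that $X$ can be identified with a measurable fundamental domain $X\subset\Omega$ for the action of $H$ with $\mu=m(X)^{-1}m|_X$, and $c$ is a Borel map satisfying $c(g_1g_2,x)=c(g_1,g_2\cdot x)c(g_2,x)$ and $g\cdot x=g\,c(g,x)\,x$ for all $g,g_1,g_2\in G$ and almost every $x\in X$ (where $g\cdot x$ is given by the action on $X$, and the right-hand side of the last equation by the actions on $\Omega$); moreover, $f:X\to Z$ is a Borel map with $f(g\cdot x)=c(g,x)\cdot f(x)$ for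 every $g\in M$ and almost every $x\in X$; 2. for all $z\in Z$, the projection to $H/N$ of the stabilizer $H_z$ of $z$ is finite; 3. $H/N$ has no nontrivial finite invariant random subgroup, i.e. every conjugation-invariant Borel probability measure on the compact space of subgroups of $H/N$ that is concentrated on finite subgroups is the point mass at the trivial subgroup. Then there exists a Borel map $\varphi:X\to H$ such that $\varphi(g\cdot x)\,c(g,x)\,\varphi(x)^{-1}\in N$ for every $g\in M$ and almost every $x\in X$. -/

import Mathlib

open MeasureTheory
open scoped Pointwise

/-- A (Borel, a.e.) cocycle `c : G × X → H` for an action of the countable group `G` on `(X, μ)`,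
written in curried form. As `G` is countable and discrete, `c` is Borel on `G × X` iff every
`c g` is Borel. -/
structure IsCocycle {G H X : Type*} [Group G] [Group H] [MeasurableSpace H]
    [MeasurableSpace X] [MulAction G X] (μ : Measure X) (c : G → X → H) : Prop where
  measurable : ∀ g, Measurable (c g)
  mul : ∀ g₁ g₂ : G, ∀ᵐ x ∂μ, c (g₁ * g₂) x = c g₁ (g₂ • x) * c g₂ x

/-- `(Ω, m)` with commuting actions of `G` and `H` (that is, an action of `G × H`) is an
ME-coupling of `G` and `H`: the actions are Borel and measure preserving, and each of them has a
measurable fundamental domain of finite measure. (For countable `G`, `H` this makes `m` σ-finite.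
As usual, the translates of a fundamental domain by distinct group elements are disjoint and
cover `Ω`, up to null sets.) -/
structure IsMECoupling (G H : Type*) {Ω : Type*} [Group G] [Group H]
    [MeasurableSpace Ω] [MulAction G Ω] [MulAction H Ω] [SMulCommClass G H Ω]
    (m : Measure Ω) : Prop where
  ne_zero : m ≠ 0
  measurable_left : MeasurableConstSMul G Ω
  measurable_right : MeasurableConstSMul H Ω
  invariant_left : SMulInvariantMeasure G Ω m
  invariant_right : SMulInvariantMeasure H Ω m
  exists_left : ∃ Y : Set Ω, MeasurableSet Y ∧ IsFundamentalDomain G Y m ∧ m Y < ⊤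
  exists_right : ∃ X : Set Ω, MeasurableSet X ∧ IsFundamentalDomain H X m ∧ m X < ⊤

/-- The cocycle `c : G × X → H` over the action of `G` on `(X, μ)` is the ME-cocycle of a
fundamental domain for `H` in the space `(Ω, m)` with commuting actions of `G` and `H`:
`(X, μ)` is identified, by a Borel isomorphism `ι`, with a fundamental domain for the action of
`H` with the normalized restriction of `m`, and, under this identification, the action of `G` on
`X` and the cocycle are given by `g · x = g c(g, x) x`, where `g · x` is the point of the
fundamental domain in the `H`-orbit of `g x`. -/
def IsMECocycleOf {G H X Ω : Type*} [Group G] [Group H] [MeasurableSpace H]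
    [MeasurableSpace X] [MulAction G X] [MeasurableSpace Ω] [MulAction G Ω] [MulAction H Ω]
    (m : Measure Ω) (μ : Measure X) (c : G → X → H) : Prop :=
  IsCocycle μ c ∧
  ∃ ι : X → Ω, MeasurableEmbedding ι ∧
    IsFundamentalDomain H (Set.range ι) m ∧
    μ = (m (Set.range ι))⁻¹ • m.comap ι ∧
    ∀ g : G, ∀ᵐ x ∂μ, ι (g • x) = g • c g x • ι x

/-- A Borel action is smooth if its orbit space, with the quotient Borel structure, is countably
separated. -/
def IsSmoothAction (H Z : Type*) [Group H] [MeasurableSpace Z] [MulAction H Z] : Prop :=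
  MeasurableSpace.CountablySeparated (Quotient (MulAction.orbitRel H Z))

/-- The topology on the space of subgroups of `K` induced from the compact space `{0, 1}^K`. -/
abbrev subgroupTopology (K : Type*) [Group K] : TopologicalSpace (Subgroup K) :=
  TopologicalSpace.generateFrom
    {A | ∃ k : K, A = {L : Subgroup K | k ∈ L} ∨ A = {L : Subgroup K | k ∉ L}}

/-- The Borel σ-algebra of the space of subgroups of `K`. -/
instance subgroupMeasurableSpace (K : Type*) [Group K] : MeasurableSpace (Subgroup K) :=
  @borel (Subgroup K) (subgroupTopology K)

/-- For countable `K`, the Borel σ-algebra on the space of subgroups is generated by the sets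
`{L | k ∈ L}`. -/
theorem subgroupMeasurableSpace_eq (K : Type*) [Group K] [Countable K] :
    subgroupMeasurableSpace K =
      MeasurableSpace.generateFrom (Set.range fun k : K => {L : Subgroup K | k ∈ L}) := by
  let _ := subgroupTopology K
  have hc : {A | ∃ k : K, A = {L : Subgroup K | k ∈ L} ∨ A = {L : Subgroup K | k ∉ L}}.Countable := by
    refine ((Set.countable_range fun k : K => {L : Subgroup K | k ∈ L}).union
      (Set.countable_range fun k : K => {L : Subgroup K | k ∉ L})).mono ?_
    rintro A ⟨k, rfl | rfl⟩
    · exact Or.inl ⟨k, rfl⟩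
    · exact Or.inr ⟨k, rfl⟩
  have : SecondCountableTopology (Subgroup K) := ⟨⟨_, hc, rfl⟩⟩
  refine (borel_eq_generateFrom_of_subbasis (α := Subgroup K) rfl).trans (le_antisymm ?_ ?_)
  · refine MeasurableSpace.generateFrom_le ?_
    rintro A ⟨k, rfl | rfl⟩
    · exact MeasurableSpace.measurableSet_generateFrom ⟨k, rfl⟩
    · exact (MeasurableSpace.measurableSet_generateFrom
        (s := Set.range fun k : K => {L : Subgroup K | k ∈ L}) ⟨k, rfl⟩).compl
  · refine MeasurableSpace.generateFrom_mono ?_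
    rintro A ⟨k, rfl⟩
    exact ⟨k, Or.inl rfl⟩

/-- An invariant random subgroup of `K`: a Borel probability measure on the space of subgroups
of `K` that is invariant under conjugation. -/
structure IsIRS {K : Type*} [Group K] (η : Measure (Subgroup K)) : Prop where
  prob : IsProbabilityMeasure η
  conj_invariant : ∀ k : K, η.map (fun L => MulAut.conj k • L) = η

/-- `K` has no nontrivial finite invariant random subgroup: every IRS of `K` that is almost surely
finite is almost surely the trivial subgroup. -/
def NoNontrivialFiniteIRS (K : Type*) [Group K] : Prop :=
  ∀ η : Measure (Subgroup K), IsIRS η → (∀ᵐ L : Subgroup K ∂η, (L : Set K).Finite) → ∀ᵐ L ∂η, L = ⊥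

/-!
Write `K = H ⧸ N` with projection `π`. The map `f` extends from the fundamental domain `X` of `H`
to an `H`-equivariant map `F : Ω → Z`, and the cocycle relation for `f` says exactly that `F` is
`M`-invariant. In these terms the conclusion asks for an `M`-invariant, `H`-equivariant map
`Ω → K`: if its value at `x ∈ X` is `a`, any measurable lift `φ x` of `a⁻¹` will do.

Smoothness of the action on `Z` and finiteness of the images of stabilizers give a weaker object:
an `M`-invariant, `H`-equivariant field of nonempty finite subsets of `K`
(`exists_equivariant_finset`). Among all such fields, take one, `S`, of least cardinality
(`IsEquivariantFinset.exists_minimal`). As `M` is normal, `S` translated by `g : G` is again such a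
field, and minimality forces `S (g • ω) = S ω * d` for some `d : K` depending on `ω`
(`IsEquivariantFinset.ae_eq_smul_of_minimal`); for `g = 1` this shows that `S ω` is a left coset of
a finite subgroup. Hence the stabilizer of `S ω` under left multiplication is a finite subgroup of
`K` that is invariant under all of `G` as a function of `ω`, and it is conjugated by `H`. Its
law on a fundamental domain of finite measure for `G` is therefore a finite invariant random
subgroup of `K` (`ae_eq_bot_of_noNontrivialFiniteIRS`), which is trivial by hypothesis. So `S ω` is
a coset of the trivial subgroup, that is, a singleton.
-/

/-! ### Equivariant fields of finite subsets -/

theorem exists_card_minimal_index {K : Type*} (S : ℕ → Finset K) :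
    ∃ n, ∀ k, (S n).card ≤ (S k).card := by
  obtain ⟨n, hn⟩ := exists_minimalFor_of_wellFoundedLT (fun _ : ℕ => True)
    (fun n => (S n).card) ⟨0, trivial⟩
  exact ⟨n, fun k => (le_total (S n).card (S k).card).elim id (hn.2 trivial)⟩

section EquivariantFinset

variable {G H K Ω : Type*} [Group G] [Group H] [Group K] [DecidableEq K]
  [MeasurableSpace Ω] [MulAction G Ω] [MulAction H Ω]

/-- A measurable field of nonempty finite subsets of `K` over `Ω`, almost everywhere equivariant for
`H` acting on the left of `K` through `π`, and almost everywhere invariant under `M`. A field of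
singletons is the same as an equivariant, `M`-invariant map to `K`. -/
structure IsEquivariantFinset (M : Subgroup G) (π : H →* K) (m : Measure Ω)
    (S : Ω → Finset K) : Prop where
  measurable : Measurable S
  nonempty : ∀ᵐ ω ∂m, (S ω).Nonempty
  smul : ∀ h : H, ∀ᵐ ω ∂m, S (h • ω) = π h • S ω
  invariant : ∀ g ∈ M, ∀ᵐ ω ∂m, S (g • ω) = S ω

theorem ae_smul_of_ae {m : Measure Ω} [MeasurableConstSMul G Ω] [SMulInvariantMeasure G Ω m]
    (g : G) {p : Ω → Prop} (h : ∀ᵐ ω ∂m, p ω) : ∀ᵐ ω ∂m, p (g • ω) :=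
  (measurePreserving_smul g m).quasiMeasurePreserving.ae h

namespace IsEquivariantFinset

variable {M : Subgroup G} {π : H →* K} {m : Measure Ω} {S T : Ω → Finset K}

/-- Translating by `g : G` preserves equivariance because `G` and `H` commute, and `M`-invariance
because `M` is normal. -/
theorem comp_smul [M.Normal] [SMulCommClass G H Ω] [MeasurableConstSMul G Ω]
    [SMulInvariantMeasure G Ω m] (hS : IsEquivariantFinset M π m S) (g : G) :
    IsEquivariantFinset M π m fun ω => S (g • ω) where
  measurable := hS.measurable.comp (measurable_const_smul g)
  nonempty := ae_smul_of_ae g hS.nonempty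
  smul h := by
    filter_upwards [ae_smul_of_ae g (hS.smul h)] with ω hω
    rw [smul_comm, hω]
  invariant n hn := by
    filter_upwards [ae_smul_of_ae g (hS.invariant (g * n * g⁻¹)
      (Subgroup.Normal.conj_mem inferInstance n hn g))] with ω hω
    rw [← hω, smul_smul, smul_smul, inv_mul_cancel_right]

theorem combine [Countable K] (hS : IsEquivariantFinset M π m S)
    (hT : IsEquivariantFinset M π m T) (Φ : Finset K → Finset K → Finset K)
    (hne : ∀ A B, A.Nonempty → B.Nonempty → (Φ A B).Nonempty)
    (hΦ : ∀ (k : K) A B, Φ (k • A) (k • B) = k • Φ A B) :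
    IsEquivariantFinset M π m fun ω => Φ (S ω) (T ω) where
  measurable := (measurable_of_countable (fun p : Finset K × Finset K => Φ p.1 p.2)).comp
    (hS.measurable.prodMk hT.measurable)
  nonempty := by
    filter_upwards [hS.nonempty, hT.nonempty] with ω h₁ h₂ using hne _ _ h₁ h₂
  smul h := by
    filter_upwards [hS.smul h, hT.smul h] with ω h₁ h₂
    rw [h₁, h₂, hΦ]
  invariant g hg := by
    filter_upwards [hS.invariant g hg, hT.invariant g hg] with ω h₁ h₂
    rw [h₁, h₂]

/-- At each point take the field of the sequence with the fewest elements, the first one if there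
are several; as the cardinalities are invariant, so is the index chosen. -/
theorem exists_le_card_seq [Countable K] {S : ℕ → Ω → Finset K}
    (hS : ∀ n, IsEquivariantFinset M π m (S n)) :
    ∃ T, IsEquivariantFinset M π m T ∧ ∀ n ω, (T ω).card ≤ (S n ω).card := by
  classical
  have hex : ∀ ω, ∃ n, ∀ k, (S n ω).card ≤ (S k ω).card := fun ω =>
    exists_card_minimal_index fun n => S n ω
  have key : ∀ ω ω' : Ω, (∀ n, (S n ω).card = (S n ω').card) →
      Nat.find (hex ω) = Nat.find (hex ω') := fun ω ω' h => by
    congr! 3; simp only [h]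
  refine ⟨fun ω => S (Nat.find (hex ω)) ω, ⟨?_, ?_, fun h => ?_, fun g hg => ?_⟩,
    fun n ω => Nat.find_spec (hex ω) n⟩
  · refine Measurable.find (fun n => (hS n).measurable) (fun n => ?_) hex
    simp only [Set.ofPred_forall]
    refine MeasurableSet.iInter fun k => ?_
    exact measurableSet_le ((measurable_of_countable Finset.card).comp (hS n).measurable)
      ((measurable_of_countable Finset.card).comp (hS k).measurable)
  · filter_upwards [ae_all_iff.2 fun n => (hS n).nonempty] with ω h using h _
  · filter_upwards [ae_all_iff.2 fun n => (hS n).smul h] with ω hω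
    rw [key (h • ω) ω fun n => by rw [hω, Finset.card_smul_finset], hω]
  · filter_upwards [ae_all_iff.2 fun n => (hS n).invariant g hg] with ω hω
    rw [key (g • ω) ω fun n => by rw [hω], hω]

open scoped ENNReal in
/-- There is an equivariant field of finite subsets with the fewest elements almost everywhere. It
maximizes the integral of a decreasing function of the cardinality. -/
theorem exists_minimal [Countable K] [SFinite m] (hS : IsEquivariantFinset M π m S) :
    ∃ S₀, IsEquivariantFinset M π m S₀ ∧
      ∀ T, IsEquivariantFinset M π m T → ∀ᵐ ω ∂m, (S₀ ω).card ≤ (T ω).card := by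
  -- the summand `1` keeps `w` finite at the empty set
  let w : Finset K → ℝ≥0∞ := fun A => ((A.card : ℝ≥0∞) + 1)⁻¹
  have hw : Measurable w := measurable_of_countable w
  have hw1 : ∀ A, w A ≤ 1 := fun A => by simp [w]
  have hwle : ∀ {A B : Finset K}, A.card ≤ B.card → w B ≤ w A := fun h => by
    simp only [w]; gcongr
  have hwlt : ∀ {A B : Finset K}, w A ≤ w B → B.card ≤ A.card := fun {A B} h => by
    simpa [w, ENNReal.inv_le_inv] using h
  let J : (Ω → Finset K) → ℝ≥0∞ := fun S => ∫⁻ ω, w (S ω) ∂m.toFinite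
  have hJ : ∀ S, J S ≤ m.toFinite Set.univ := fun S => by
    simpa using lintegral_mono (μ := m.toFinite) fun ω => hw1 (S ω)
  obtain ⟨u, -, hu, huS⟩ := exists_seq_tendsto_sSup
    (S := J '' {S | IsEquivariantFinset M π m S}) (Set.Nonempty.image J ⟨S, hS⟩)
    (OrderTop.bddAbove _)
  choose R hR hRu using huS
  obtain ⟨T₀, hT₀, hle⟩ := exists_le_card_seq hR
  have hmax : ∀ T, IsEquivariantFinset M π m T → J T ≤ J T₀ := fun T hT => by
    refine (le_sSup (Set.mem_image_of_mem J hT)).trans (le_of_tendsto' hu fun n => ?_)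
    rw [← hRu n]
    exact lintegral_mono fun ω => hwle (hle n ω)
  refine ⟨T₀, hT₀, fun T hT => ?_⟩
  -- otherwise replacing `T₀` by `T` wherever `T` is smaller would increase `J`
  let Φ : Finset K → Finset K → Finset K := fun A B => if B.card < A.card then B else A
  have hΦ : IsEquivariantFinset M π m fun ω => Φ (T₀ ω) (T ω) := by
    refine hT₀.combine hT Φ (fun A B hA hB => ?_) fun k A B => ?_
    · dsimp only [Φ]; split_ifs <;> assumption
    · simp only [Φ, Finset.card_smul_finset]; split_ifs <;> rfl
  have hΦA : ∀ A B, (Φ A B).card ≤ A.card ∧ (Φ A B).card ≤ B.card := fun A B => by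
    dsimp only [Φ]; split_ifs <;> omega
  have hae : (fun ω => w (T₀ ω)) =ᵐ[m.toFinite] fun ω => w (Φ (T₀ ω) (T ω)) :=
    ae_eq_of_ae_le_of_lintegral_le (.of_forall fun ω => hwle (hΦA _ _).1)
      ((hJ T₀).trans_lt (measure_lt_top _ _)).ne
      (hw.comp hΦ.measurable).aemeasurable (hmax _ hΦ)
  rw [Filter.EventuallyEq, ae_toFinite] at hae
  filter_upwards [hae] with ω hω
  exact (hwlt hω.ge).trans (hΦA _ _).2

open MulOpposite in
/-- A minimal field `S` and its translate by `g` differ by a right translation: the field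
`S d ∩ (S ∘ g)` is again equivariant wherever it is nonempty, hence is not smaller than `S`. -/
theorem ae_eq_smul_of_minimal [Countable K] [M.Normal] [SMulCommClass G H Ω]
    [MeasurableConstSMul G Ω] [SMulInvariantMeasure G Ω m] (hS : IsEquivariantFinset M π m S)
    (hmin : ∀ T, IsEquivariantFinset M π m T → ∀ᵐ ω ∂m, (S ω).card ≤ (T ω).card) (g : G) :
    ∀ᵐ ω ∂m, ∀ a ∈ S ω, ∀ b ∈ S (g • ω), S (g • ω) = op (a⁻¹ * b) • S ω := by
  let Φ : K → Finset K → Finset K → Finset K := fun d A B =>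
    if (op d • A ∩ B).Nonempty then op d • A ∩ B else A
  have hΦ : ∀ d, IsEquivariantFinset M π m fun ω => Φ d (S ω) (S (g • ω)) := fun d => by
    refine hS.combine (hS.comp_smul g) (Φ d) (fun A B hA hB => ?_) fun k A B => ?_
    · dsimp only [Φ]; split_ifs <;> assumption
    · simp only [Φ, smul_comm (op d) k, ← Finset.smul_finset_inter, Finset.smul_finset_nonempty]
      split_ifs <;> rfl
  filter_upwards [ae_all_iff.2 fun d => hmin _ (hΦ d),
    ae_smul_of_ae g (hmin _ (hS.comp_smul g⁻¹))] with ω h₁ h₂ a ha b hb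
  rw [inv_smul_smul] at h₂
  have hab : b ∈ op (a⁻¹ * b) • S ω ∩ S (g • ω) := by
    refine Finset.mem_inter.2 ⟨?_, hb⟩
    simpa [op_smul_eq_mul] using Finset.smul_mem_smul_finset (a := op (a⁻¹ * b)) ha
  have h := h₁ (a⁻¹ * b)
  rw [show Φ (a⁻¹ * b) (S ω) (S (g • ω)) = _ from if_pos ⟨b, hab⟩] at h
  have hsub : op (a⁻¹ * b) • S ω ⊆ S (g • ω) := by
    have := Finset.eq_of_subset_of_card_le Finset.inter_subset_left
      ((Finset.card_smul_finset (op (a⁻¹ * b)) (S ω)).trans_le h)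
    exact this ▸ Finset.inter_subset_right
  exact (Finset.eq_of_subset_of_card_le hsub
    (h₂.trans_eq (Finset.card_smul_finset _ _).symm)).symm

end IsEquivariantFinset

open MulOpposite in
/-- The hypothesis `h` says that `A` is a left coset `a B` of a subgroup `B`; its stabilizer under
left multiplication is `a B a⁻¹`. -/
theorem card_eq_one_of_stabilizer_eq_bot {A : Finset K} (hA : A.Nonempty)
    (h : ∀ a ∈ A, ∀ b ∈ A, A = op (a⁻¹ * b) • A) (hst : MulAction.stabilizer K A = ⊥) :
    A.card = 1 := by
  refine le_antisymm (Finset.card_le_one.2 fun a ha b hb => ?_) hA.card_pos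
  suffices hb' : b * a⁻¹ ∈ MulAction.stabilizer K A by
    rw [hst, Subgroup.mem_bot] at hb'
    exact (mul_inv_eq_one.1 hb').symm
  refine Finset.eq_of_subset_of_card_le (fun x hx => ?_) (Finset.card_smul_finset _ _).ge
  obtain ⟨s, hs, rfl⟩ := Finset.mem_smul_finset.1 hx
  rw [h a ha s hs]
  simpa [mul_assoc] using Finset.smul_mem_smul_finset (a := op (a⁻¹ * s)) hb

theorem finite_stabilizer {A : Finset K} (hA : A.Nonempty) :
    (MulAction.stabilizer K A : Set K).Finite := by
  obtain ⟨a, ha⟩ := hA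
  refine ((A * {a⁻¹}).finite_toSet).subset fun k hk => ?_
  have : k * a ∈ A := by
    have := Finset.smul_mem_smul_finset (a := k) ha
    rwa [MulAction.mem_stabilizer_iff.1 hk] at this
  exact Finset.mem_coe.2 (Finset.mem_mul.2 ⟨_, this, a⁻¹, by simp, by simp⟩)

end EquivariantFinset

/-! ### Invariant random subgroups from a coupling -/

section InvariantRandomSubgroup

theorem measurable_subgroup_mem {K : Type*} [Group K] [Countable K] (k : K) :
    Measurable fun L : Subgroup K => k ∈ L := by
  refine measurableSet_setOfPred.1 ?_
  rw [subgroupMeasurableSpace_eq]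
  exact MeasurableSpace.measurableSet_generateFrom ⟨k, rfl⟩

theorem measurable_subgroup_iff {K α : Type*} [Group K] [Countable K] [MeasurableSpace α]
    {L : α → Subgroup K} : Measurable L ↔ ∀ k, Measurable fun x => k ∈ L x := by
  refine ⟨fun hL k => (measurable_subgroup_mem k).comp hL, fun h => ?_⟩
  rw [subgroupMeasurableSpace_eq]
  refine measurable_generateFrom ?_
  rintro _ ⟨k, rfl⟩
  exact measurableSet_setOfPred.2 (h k)

theorem measurableSet_subgroup_finite {K : Type*} [Group K] [Countable K] :
    MeasurableSet {L : Subgroup K | (L : Set K).Finite} := by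
  have : Measurable fun L : Subgroup K => (L : Set K) :=
    measurable_set_iff.2 fun k => measurable_subgroup_mem k
  exact this MeasurableSet.setOfPred_finite

theorem measurable_conj_smul {K : Type*} [Group K] [Countable K] (k : K) :
    Measurable fun L : Subgroup K => MulAut.conj k • L := by
  refine measurable_subgroup_iff.2 fun x => ?_
  simpa only [Subgroup.mem_pointwise_smul_iff_inv_smul_mem] using measurable_subgroup_mem _

theorem MeasureTheory.IsFundamentalDomain.measure_inter_eq_of_ae_invariant {G Ω : Type*}
    [Group G] [Countable G] [MeasurableSpace Ω] [MulAction G Ω] {m : Measure Ω} [MeasurableConstSMul G Ω]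
    [SMulInvariantMeasure G Ω m] {s t B : Set Ω} (hs : IsFundamentalDomain G s m)
    (ht : IsFundamentalDomain G t m) (hB : MeasurableSet B)
    (hinv : ∀ g : G, ∀ᵐ ω ∂m, g • ω ∈ B ↔ ω ∈ B) : m (B ∩ s) = m (B ∩ t) := by
  set A : Set Ω := ⋂ g : G, (fun ω => g • ω) ⁻¹' B with hA
  have hAm : MeasurableSet A := MeasurableSet.iInter fun g => measurable_const_smul g hB
  have hAB : A =ᵐ[m] B := by
    refine Filter.eventuallyEq_set.2 ?_
    filter_upwards [ae_all_iff.2 hinv] with ω hω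
    exact Set.mem_iInter.trans ⟨fun h => by simpa using h 1, fun h g => (hω g).2 h⟩
  have hAinv : ∀ g : G, (fun ω => g • ω) ⁻¹' A = A := fun g => by
    ext ω
    simp only [hA, Set.mem_preimage, Set.mem_iInter, smul_smul]
    exact ⟨fun h k => by simpa using h (k * g⁻¹), fun h k => h (k * g)⟩
  rw [← measure_congr (hAB.inter (ae_eq_refl s)), ← measure_congr (hAB.inter (ae_eq_refl t))]
  exact hs.measure_set_eq ht hAm hAinv

theorem ae_of_ae_restrict_fundamentalDomain {G Ω : Type*} [Group G] [Countable G]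
    [MeasurableSpace Ω] [MulAction G Ω] {m : Measure Ω} [MeasurableConstSMul G Ω]
    [SMulInvariantMeasure G Ω m] {s : Set Ω} (hs : IsFundamentalDomain G s m)
    {p : Ω → Prop} (hp : ∀ᵐ ω ∂m.restrict s, p ω)
    (hinv : ∀ g : G, ∀ᵐ ω ∂m, p (g • ω) → p ω) : ∀ᵐ ω ∂m, p ω := by
  have h := (ae_restrict_iff'₀ hs.nullMeasurableSet).1 hp
  filter_upwards [ae_all_iff.2 hinv, hs.ae_covers,
    ae_all_iff.2 fun g : G => ae_smul_of_ae g h] with ω h₁ ⟨g, hg⟩ h₂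
  exact h₁ g (h₂ g hg)

/-- An almost everywhere `G`-invariant, `H`-equivariant field `L` of finite subgroups of `K` is
trivial: by `G`-invariance, the law of `L` on a fundamental domain `Y` of `G` is the law on any
translate of `Y` by `H`, so that it is an invariant random subgroup. -/
theorem ae_eq_bot_of_noNontrivialFiniteIRS {G H K Ω : Type*} [Group G] [Countable G] [Group H]
    [Group K] [Countable K] [MeasurableSpace Ω] [MulAction G Ω] [MulAction H Ω]
    [SMulCommClass G H Ω] {m : Measure Ω} (hm : IsMECoupling G H m)
    (hK : NoNontrivialFiniteIRS K) {π : H →* K} (hπ : Function.Surjective π)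
    {L : Ω → Subgroup K} (hL : Measurable L) (hfin : ∀ᵐ ω ∂m, (L ω : Set K).Finite)
    (hLH : ∀ h : H, ∀ᵐ ω ∂m, L (h • ω) = MulAut.conj (π h) • L ω)
    (hLG : ∀ g : G, ∀ᵐ ω ∂m, L (g • ω) = L ω) : ∀ᵐ ω ∂m, L ω = ⊥ := by
  have := hm.measurable_left
  have := hm.measurable_right
  have := hm.invariant_left
  have := hm.invariant_right
  obtain ⟨Y, hYm, hY, hYfin⟩ := hm.exists_left
  have hY0 : m Y ≠ 0 := hY.measure_ne_zero hm.ne_zero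
  have hYc : (m Y)⁻¹ ≠ 0 := ENNReal.inv_ne_zero.2 hYfin.ne
  set η : Measure (Subgroup K) := (m Y)⁻¹ • (m.restrict Y).map L with hη
  have hconj : ∀ h : H, ((m.restrict Y).map L).map (fun M => MulAut.conj (π h) • M) =
      (m.restrict Y).map L := fun h => by
    ext A hA
    rw [Measure.map_map (measurable_conj_smul _) hL,
      Measure.map_apply ((measurable_conj_smul _).comp hL) hA, Measure.map_apply hL hA,
      Measure.restrict_apply ((measurable_conj_smul _).comp hL hA),
      Measure.restrict_apply (hL hA)]
    have hae : ((fun M => MulAut.conj (π h) • M) ∘ L) ⁻¹' A =ᵐ[m] (fun ω => h • ω) ⁻¹' (L ⁻¹' A) := by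
      filter_upwards [hLH h] with ω hω
      refine propext ?_
      change MulAut.conj (π h) • L ω ∈ A ↔ L (h • ω) ∈ A
      rw [hω]
    have hpre : (fun ω => h • ω) ⁻¹' (L ⁻¹' A) ∩ Y = (fun ω => h • ω) ⁻¹' (L ⁻¹' A ∩ h • Y) := by
      ext ω; simp [Set.smul_mem_smul_set_iff]
    rw [measure_congr (hae.inter (ae_eq_refl Y)), hpre, measure_preimage_smul]
    have hcomm : SMulCommClass H G Ω := SMulCommClass.symm _ _ _
    refine IsFundamentalDomain.measure_inter_eq_of_ae_invariant (hY.smul_of_comm h) hY (hL hA)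
      fun g => ?_
    filter_upwards [hLG g] with ω hω
    rw [Set.mem_preimage, Set.mem_preimage, hω]
  have hIRS : IsIRS η := by
    refine ⟨⟨?_⟩, fun k => ?_⟩
    · rw [hη, Measure.smul_apply, Measure.map_apply hL MeasurableSet.univ, Set.preimage_univ,
        Measure.restrict_apply_univ, smul_eq_mul, ENNReal.inv_mul_cancel hY0 hYfin.ne]
    · obtain ⟨h, rfl⟩ := hπ k
      rw [hη, Measure.map_smul, hconj h]
  have hbot := hK η hIRS (by
    rw [hη, Measure.ae_ennreal_smul_measure_iff hYc,
      ae_map_iff hL.aemeasurable measurableSet_subgroup_finite]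
    exact ae_restrict_of_ae hfin)
  rw [hη, Measure.ae_ennreal_smul_measure_iff hYc] at hbot
  refine ae_of_ae_restrict_fundamentalDomain hY (ae_of_ae_map hL.aemeasurable hbot) fun g => ?_
  filter_upwards [hLG g] with ω hω h
  rwa [← hω]

end InvariantRandomSubgroup

/-! ### Finite sets of largest atoms for smooth actions -/

section Smooth
open ProbabilityTheory

/-- The values `z ∈ O` taken by `F` with the largest probability form a finite nonempty set, if `F`
takes values in the countable set `O` with positive probability: the total mass is finite, so only
finitely many values have mass at least a given positive number. -/
theorem finite_setOf_isMax_measure {α Z : Type*} [MeasurableSpace α] (ν : Measure α)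
    [IsFiniteMeasure ν] {F : α → Z} (hF : ∀ z, MeasurableSet (F ⁻¹' {z})) (O : Set Z)
    (hO : O.Countable) (hν : ν (F ⁻¹' O) ≠ 0) :
    {z ∈ O | ∀ z' ∈ O, ν (F ⁻¹' {z'}) ≤ ν (F ⁻¹' {z})}.Finite ∧
    {z ∈ O | ∀ z' ∈ O, ν (F ⁻¹' {z'}) ≤ ν (F ⁻¹' {z})}.Nonempty := by
  obtain ⟨z₀, hz₀, h₀⟩ : ∃ z ∈ O, ν (F ⁻¹' {z}) ≠ 0 := by
    by_contra! h
    refine hν ?_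
    rw [← Set.biUnion_preimage_singleton]
    exact (measure_biUnion_null_iff hO).2 h
  have hfin : ∀ ε : ENNReal, ε ≠ 0 → {z | ε ≤ ν (F ⁻¹' {z})}.Finite := fun ε hε =>
    Measure.finite_const_le_meas_of_disjoint_iUnion ν (pos_iff_ne_zero.2 hε) hF
      (fun a b hab => Disjoint.preimage F (by simpa using hab)) (measure_ne_top _ _)
  refine ⟨(hfin _ h₀).subset fun z hz => hz.2 z₀ hz₀, ?_⟩
  obtain ⟨z, hz, hmax⟩ := ((hfin _ h₀).inter_of_right O).exists_maximalFor
    (fun z => ν (F ⁻¹' {z})) _ ⟨z₀, hz₀, le_refl (ν (F ⁻¹' {z₀}))⟩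
  refine ⟨z, hz.1, fun z' hz' => ?_⟩
  rcases le_total (ν (F ⁻¹' {z'})) (ν (F ⁻¹' {z})) with h | h
  · exact h
  · exact hmax ⟨hz', hz.2.trans h⟩ h

theorem finite_image_setOf_inv_smul_mem {H K Z : Type*} [Group H] [Group K] [MulAction H Z]
    (π : H →* K) {z : Z} (hz : ((MulAction.stabilizer H z).map π : Set K).Finite)
    {P : Set Z} (hP : P.Finite) : (π '' {h : H | h⁻¹ • z ∈ P}).Finite := by
  have hU : {h : H | h⁻¹ • z ∈ P} = ⋃ z' ∈ P, {h : H | h⁻¹ • z = z'} := by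
    ext h; simp
  rw [hU, Set.image_iUnion₂]
  refine hP.biUnion fun z' _ => ?_
  rcases Set.eq_empty_or_nonempty {h : H | h⁻¹ • z = z'} with h | ⟨h₀, h₀'⟩
  · simp [h]
  refine (hz.mul (Set.finite_singleton (π h₀))).subset ?_
  rintro _ ⟨h, hh, rfl⟩
  refine Set.mem_mul.2 ⟨π (h * h₀⁻¹), ⟨h * h₀⁻¹, ?_, rfl⟩, π h₀, rfl, by simp⟩
  have e : h₀⁻¹ • z = h⁻¹ • z := Eq.trans h₀' (Eq.symm hh)
  simp [MulAction.mem_stabilizer_iff, mul_smul, e]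

/-- A smooth action has a Borel complete invariant of orbits with values in the Cantor space. -/
theorem IsSmoothAction.exists_invariant {H Z : Type*} [Group H] [MeasurableSpace Z] [MulAction H Z]
    (h : IsSmoothAction H Z) :
    ∃ q : Z → ℕ → Bool, Measurable q ∧ ∀ z z', q z = q z' ↔ z ∈ MulAction.orbit H z' := by
  have : MeasurableSpace.CountablySeparated (Quotient (MulAction.orbitRel H Z)) := h
  obtain ⟨j, hj, hinj⟩ := MeasurableSpace.measurable_injection_nat_bool_of_countablySeparated
    (Quotient (MulAction.orbitRel H Z))
  refine ⟨fun z => j (Quotient.mk (MulAction.orbitRel H Z) z), hj.comp fun s hs => hs,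
    fun z z' => ?_⟩
  rw [hinj.eq_iff, Quotient.eq]
  exact MulAction.orbitRel_apply

/-- For a smooth action with stabilizers of finite image in `K`, there is an exactly equivariant
Borel map from `Z` to the finite subsets of `K`, nonempty almost everywhere for the law of `F`.
The law of `F` conditioned on the orbit lives on a countable set, so has finitely many atoms of
largest mass; the value at `z` is the image of the set of `h` for which `h⁻¹ • z` is one of them.
This needs no Borel section of the orbits, and `Z` only has to be countably separated, because the
conditional measures are taken on the standard Borel space `Ω`. -/
theorem exists_equivariant_finset {H K Z Ω : Type*} [Group H] [Countable H] [Group K]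
    [Countable K] [DecidableEq K] [MeasurableSpace Z] [MeasurableSpace.CountablySeparated Z]
    [MulAction H Z] [MeasurableConstSMul H Z] (hsmooth : IsSmoothAction H Z) (π : H →* K)
    (hstab : ∀ z : Z, ((MulAction.stabilizer H z).map π : Set K).Finite)
    [MeasurableSpace Ω] [StandardBorelSpace Ω] (ν : Measure Ω) [IsFiniteMeasure ν]
    {F : Ω → Z} (hF : Measurable F) :
    ∃ B : Z → Finset K, Measurable B ∧ (∀ (h : H) z, B (h • z) = π h • B z) ∧
      ∀ᵐ ω ∂ν, (B (F ω)).Nonempty := by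
  classical
  obtain ⟨q, hq, hqorb⟩ := hsmooth.exists_invariant
  rcases isEmpty_or_nonempty Ω with hΩ | hΩ
  · exact ⟨fun _ => ∅, measurable_const, by simp, by simp [Measure.eq_zero_of_isEmpty]⟩
  have hdiag : MeasurableEq Z := by
    obtain ⟨j, hj, hinj⟩ := MeasurableSpace.measurable_injection_nat_bool_of_countablySeparated Z
    refine ⟨?_⟩
    have := measurableSet_eq_fun (hj.comp measurable_fst) (hj.comp (measurable_snd (α := Z)))
    simpa [hinj.eq_iff, Set.diagonal] using this
  -- the conditional measures are the disintegration of the graph of the orbit invariant `q ∘ F`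
  set ρ : Measure ((ℕ → Bool) × Ω) := ν.map fun ω => (q (F ω), ω) with hρ
  have hqF : Measurable fun ω => q (F ω) := hq.comp hF
  have hρm : Measurable fun ω => (q (F ω), ω) := hqF.prodMk measurable_id
  let κ : Kernel Z Ω := ρ.condKernel.comap q hq
  let w : Z → H → ENNReal := fun z h => κ z (F ⁻¹' {h⁻¹ • z})
  have hw : ∀ h, Measurable fun z => w z h := fun h => by
    have hD : MeasurableSet {p : Z × Ω | F p.2 = h⁻¹ • p.1} :=
      measurableSet_eq_fun (hF.comp measurable_snd)
        ((measurable_const_smul h⁻¹).comp measurable_fst)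
    exact Kernel.measurable_kernel_prodMk_left (κ := κ) hD
  have hwsmul : ∀ h z h', w (h • z) h' = w z (h⁻¹ * h') := fun h z h' => by
    have : q (h • z) = q z := (hqorb _ _).2 (MulAction.mem_orbit z h)
    simp only [w, κ, Kernel.comap_apply, this, mul_inv_rev, inv_inv, mul_smul]
  let A : Z → Set K := fun z => π '' {h | ∀ h', w z h' ≤ w z h}
  have hA : Measurable A := by
    refine measurable_set_iff.2 fun k => measurableSet_setOfPred.1 ?_
    have : {z | k ∈ A z} = ⋃ h ∈ {h | π h = k}, ⋂ h', {z | w z h' ≤ w z h} := by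
      ext z; simp [A, and_comm]
    rw [this]
    exact MeasurableSet.biUnion (Set.to_countable _) fun h _ =>
      MeasurableSet.iInter fun h' => measurableSet_le (hw h') (hw h)
  have hAsmul : ∀ h z, A (h • z) = π h • A z := fun h z => by
    simp only [A, hwsmul]
    ext k
    simp only [Set.mem_smul_set_iff_inv_smul_mem, Set.mem_image, Set.mem_ofPred_eq]
    constructor
    · rintro ⟨h', hh', rfl⟩
      exact ⟨h⁻¹ * h', fun x => by simpa using hh' (h * x), by simp⟩
    · rintro ⟨h', hh', e⟩
      exact ⟨h * h', fun x => by simpa using hh' (h⁻¹ * x), by simp [e]⟩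
  have hAfin : ∀ᵐ ω ∂ν, (A (F ω)).Finite ∧ (A (F ω)).Nonempty := by
    have h₁ : ∀ᵐ p ∂(ρ.fst ⊗ₘ ρ.condKernel), q (F p.2) = p.1 := by
      rw [ρ.disintegrate ρ.condKernel, hρ, ae_map_iff hρm.aemeasurable
        (measurableSet_eq_fun (f := fun p : (ℕ → Bool) × Ω => q (F p.2))
          (hqF.comp measurable_snd) measurable_fst)]
      exact .of_forall fun _ => rfl
    have h₂ := Measure.ae_ae_of_ae_compProd h₁
    have hfst : ρ.fst = ν.map fun ω => q (F ω) := Measure.fst_map_prodMk measurable_id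
    rw [hfst] at h₂
    filter_upwards [ae_of_ae_map hqF.aemeasurable h₂] with ω hω
    have hne : κ (F ω) (F ⁻¹' MulAction.orbit H (F ω)) ≠ 0 := by
      intro h0
      have hω' : ∀ᵐ ω' ∂κ (F ω), q (F ω') = q (F ω) := hω
      obtain ⟨ω', h1, h2⟩ := ((measure_eq_zero_iff_ae_notMem.1 h0).and hω').exists
      exact h1 ((hqorb _ _).1 h2)
    obtain ⟨hfin, hnon⟩ := finite_setOf_isMax_measure (κ (F ω))
      (fun z => hF (measurableSet_singleton z)) _ (Set.countable_range fun h : H => h • F ω) hne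
    constructor
    · refine (finite_image_setOf_inv_smul_mem π (hstab (F ω)) hfin).subset
        (Set.image_mono fun h hh => ⟨⟨h⁻¹, rfl⟩, ?_⟩)
      rintro _ ⟨h', rfl⟩
      simpa [w] using hh h'⁻¹
    · obtain ⟨_, ⟨h, rfl⟩, hmax⟩ := hnon
      refine ⟨π h⁻¹, h⁻¹, fun h' => ?_, rfl⟩
      simpa [w] using hmax _ ⟨h'⁻¹, rfl⟩
  refine ⟨fun z => if h : (A z).Finite then h.toFinset else ∅, ?_, fun h z => ?_, ?_⟩
  · refine measurable_finset_iff.2 fun k => measurableSet_setOfPred.1 ?_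
    have : {z | k ∈ if h : (A z).Finite then h.toFinset else ∅} =
        A ⁻¹' {s | s.Finite} ∩ {z | k ∈ A z} := by
      ext z
      by_cases h : (A z).Finite <;> simp [h]
    rw [this]
    exact (hA MeasurableSet.setOfPred_finite).inter
      (measurableSet_setOfPred.2 (measurable_set_iff.1 hA k))
  · by_cases hz : (A z).Finite
    · have hz' : (A (h • z)).Finite := hAsmul h z ▸ hz.smul_set
      simp only [dif_pos hz, dif_pos hz']
      apply Finset.coe_injective
      simp [hAsmul]
    · have hz' : ¬ (A (h • z)).Finite := by rwa [hAsmul, Set.finite_smul_set]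
      simp only [dif_neg hz, dif_neg hz', Finset.smul_finset_empty]
  · filter_upwards [hAfin] with ω hω
    rw [dif_pos hω.1]
    simpa using hω.2

end Smooth

/-! ### Fundamental domains and extension of equivariant maps -/

section Extension

theorem MeasureTheory.IsFundamentalDomain.ae_eq_of_smul_mem {H Ω : Type*} [Group H] [Countable H]
    [MeasurableSpace Ω] [MulAction H Ω] {m : Measure Ω} {s : Set Ω}
    (hs : IsFundamentalDomain H s m) :
    ∀ᵐ ω ∂m, ∀ h h' : H, h • ω ∈ s → h' • ω ∈ s → h = h' := by
  refine ae_all_iff.2 fun h => ae_all_iff.2 fun h' => ?_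
  rcases eq_or_ne h h' with rfl | hne
  · simp
  filter_upwards [measure_eq_zero_iff_ae_notMem.1 (hs.aedisjoint (inv_injective.ne hne))]
    with ω hω h₁ h₂
  exact absurd ⟨Set.mem_inv_smul_set_iff.2 h₁, Set.mem_inv_smul_set_iff.2 h₂⟩ hω

theorem MeasureTheory.IsFundamentalDomain.sFinite {H Ω : Type*} [Group H] [Countable H]
    [MeasurableSpace Ω] [MulAction H Ω] {m : Measure Ω} [MeasurableConstSMul H Ω]
    [SMulInvariantMeasure H Ω m] {s : Set Ω} (hs : IsFundamentalDomain H s m) (hfin : m s < ⊤) :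
    SFinite m := by
  have : ∀ h : H, IsFiniteMeasure (m.restrict (h • s)) := fun h =>
    ⟨by rwa [Measure.restrict_apply_univ, measure_smul]⟩
  rw [← hs.sum_restrict]
  infer_instance

/-- A map on a fundamental domain of `H` extends to an almost everywhere `H`-equivariant map. -/
theorem exists_equivariant_extension {H X Z Ω : Type*} [Group H] [Countable H]
    [MeasurableSpace X] [Nonempty X] [MeasurableSpace Z] [MulAction H Z] [MeasurableConstSMul H Z]
    [MeasurableSpace Ω] [MulAction H Ω] [MeasurableConstSMul H Ω] {m : Measure Ω}
    [SMulInvariantMeasure H Ω m] {ι : X → Ω}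
    (hι : MeasurableEmbedding ι) (hdom : IsFundamentalDomain H (Set.range ι) m)
    {f : X → Z} (hf : Measurable f) :
    ∃ F : Ω → Z, Measurable F ∧ (∀ h : H, ∀ᵐ ω ∂m, F (h • ω) = h • F ω) ∧
      ∀ᵐ ω ∂m, ∀ x, ω = ι x → F ω = f x := by
  classical
  obtain ⟨f', hf', hf'ι⟩ := hι.exists_measurable_extend hf fun _ => ‹Nonempty X›.map f
  obtain ⟨e, he⟩ := exists_surjective_nat H
  let p : ℕ → Ω → Prop := fun n ω => e n • ω ∈ Set.range ι ∨ ∀ k, e k • ω ∉ Set.range ι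
  have hex : ∀ ω, ∃ n, p n ω := fun ω => by
    by_cases h : ∃ k, e k • ω ∈ Set.range ι
    · exact h.imp fun k hk => Or.inl hk
    · exact ⟨0, Or.inr (not_exists.1 h)⟩
  have hpm : ∀ n, MeasurableSet {ω | p n ω} := fun n => by
    have hR := fun k => measurable_const_smul (e k) hι.measurableSet_range
    have := (hR n).union (MeasurableSet.iInter fun k => (hR k).compl)
    convert this using 1
    ext ω; simp [p]
  let F : Ω → Z := fun ω => (e (Nat.find (hex ω)))⁻¹ • f' (e (Nat.find (hex ω)) • ω)
  have hFm : Measurable F := Measurable.find (f := fun n ω => (e n)⁻¹ • f' (e n • ω))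
    (fun n => (hf'.comp (measurable_const_smul _)).const_smul _) hpm hex
  have hF : ∀ᵐ ω ∂m, ∀ (h : H) x, h • ω = ι x → F ω = h⁻¹ • f x := by
    filter_upwards [IsFundamentalDomain.ae_eq_of_smul_mem hdom] with ω hω h x hx
    have hfind : e (Nat.find (hex ω)) = h := by
      refine hω _ _ ((Nat.find_spec (hex ω)).resolve_right fun hno => ?_) ⟨x, hx.symm⟩
      obtain ⟨k, rfl⟩ := he h
      exact hno k ⟨x, hx.symm⟩
    simp only [F, hfind, hx]
    rw [← hf'ι, Function.comp_apply]
  refine ⟨F, hFm, fun h => ?_, ?_⟩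
  · filter_upwards [hF, ae_smul_of_ae h hF, hdom.ae_covers] with ω h₁ h₂ ⟨k, x, hx⟩
    rw [h₁ k x hx.symm, h₂ (k * h⁻¹) x (by rw [smul_smul, inv_mul_cancel_right, hx]),
      mul_inv_rev, inv_inv, mul_smul]
  · filter_upwards [hF] with ω hω x hx
    simpa using hω 1 x (by simpa using hx)

end Extension

/-! ### Reduction of the cocycle -/

/-- For a minimal field `T`, the left stabilizer of `T ω` is insensitive to right translations of
`T ω`, so it is `G`-invariant as a function of `ω`, although `T` is only `M`-invariant. -/
theorem IsMECoupling.exists_equivariant_singleton {G H K Ω : Type*} [Group G] [Countable G]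
    [Group H] [Countable H] [Group K] [Countable K] [DecidableEq K]
    [MeasurableSpace Ω] [MulAction G Ω] [MulAction H Ω]
    [SMulCommClass G H Ω] {m : Measure Ω} (hm : IsMECoupling G H m)
    (hK : NoNontrivialFiniteIRS K) {π : H →* K} (hπ : Function.Surjective π)
    {M : Subgroup G} [M.Normal] {S : Ω → Finset K} (hS : IsEquivariantFinset M π m S) :
    ∃ T, IsEquivariantFinset M π m T ∧ ∀ᵐ ω ∂m, (T ω).card = 1 := by
  have := hm.measurable_left
  have := hm.measurable_right
  have := hm.invariant_left
  have := hm.invariant_right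
  obtain ⟨Y, -, hY, hYfin⟩ := hm.exists_right
  have := IsFundamentalDomain.sFinite hY hYfin
  obtain ⟨T, hT, hmin⟩ := hS.exists_minimal
  have htrans := hT.ae_eq_smul_of_minimal hmin
  refine ⟨T, hT, ?_⟩
  have hbot : ∀ᵐ ω ∂m, MulAction.stabilizer K (T ω) = ⊥ := by
    refine ae_eq_bot_of_noNontrivialFiniteIRS hm hK hπ (L := fun ω => MulAction.stabilizer K (T ω))
      ((measurable_of_countable (MulAction.stabilizer K)).comp hT.measurable) ?_
      (fun h => ?_) fun g => ?_
    · filter_upwards [hT.nonempty] with ω hω using finite_stabilizer hω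
    · filter_upwards [hT.smul h] with ω hω
      rw [hω, MulAction.stabilizer_smul_eq_stabilizer_map_conj]
      rfl
    · filter_upwards [htrans g, hT.nonempty, ae_smul_of_ae g hT.nonempty]
        with ω hω ⟨a, ha⟩ ⟨b, hb⟩
      rw [hω a ha b hb]
      ext k
      simp only [MulAction.mem_stabilizer_iff, smul_comm k, smul_left_cancel_iff]
  filter_upwards [hbot, hT.nonempty, htrans 1] with ω h₁ h₂ h₃
  rw [one_smul] at h₃
  exact card_eq_one_of_stabilizer_eq_bot h₂ h₃ h₁

theorem lemma4p1 {G H X Ω Z : Type*}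
    [Group G] [Countable G]
    [Group H] [Countable H] [MeasurableSpace H] [DiscreteMeasurableSpace H]
    (M : Subgroup G) [M.Normal] (N : Subgroup H) [N.Normal]
    -- the pmp action of `G` on the standard probability space `(X, μ)`
    [MeasurableSpace X] [StandardBorelSpace X] (μ : Measure X) [IsProbabilityMeasure μ]
    [MulAction G X] [MeasurableConstSMul G X] [SMulInvariantMeasure G X μ]
    -- the smooth Borel action of `H` on `Z`
    [MeasurableSpace Z] [MeasurableSpace.CountablySeparated Z]
    [MulAction H Z] [MeasurableConstSMul H Z] (hsmooth : IsSmoothAction H Z)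
    -- an ME-coupling `(Ω, m)` of `G` and `H`, and an ME-cocycle `c` arising from it
    [MeasurableSpace Ω] [StandardBorelSpace Ω] [MulAction G Ω] [MulAction H Ω]
    [SMulCommClass G H Ω] (m : Measure Ω) (hm : IsMECoupling G H m)
    (c : G → X → H) (hc : IsMECocycleOf m μ c)
    (f : X → Z) (hf : Measurable f)
    (hfc : ∀ g ∈ M, ∀ᵐ x ∂μ, f (g • x) = c g x • f x)
    (hstab : ∀ z : Z,
      ((MulAction.stabilizer H z).map (QuotientGroup.mk' N) : Set (H ⧸ N)).Finite)
    (hIRS : NoNontrivialFiniteIRS (H ⧸ N)) :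
    ∃ φ : X → H, Measurable φ ∧
      ∀ g ∈ M, ∀ᵐ x ∂μ, φ (g • x) * c g x * (φ x)⁻¹ ∈ N := by
  classical
  obtain ⟨-, ι, hι, hdom, hμ, hcι⟩ := hc
  have := hm.measurable_left
  have := hm.measurable_right
  have := hm.invariant_left
  have := hm.invariant_right
  have hX : Nonempty X := nonempty_of_isProbabilityMeasure μ
  have : SFinite m := by
    obtain ⟨Y, -, hY, hYfin⟩ := hm.exists_right
    exact IsFundamentalDomain.sFinite hY hYfin
  -- if `m (range ι)` were infinite, its inverse, and hence `μ`, would vanish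
  have hscale : (m (Set.range ι))⁻¹ ≠ 0 := fun h => by
    rw [h, zero_smul] at hμ
    exact IsProbabilityMeasure.ne_zero μ hμ
  have hmap : ∀ {p : Ω → Prop}, (∀ᵐ x ∂μ, p (ι x)) ↔ ∀ᵐ ω ∂m.restrict (Set.range ι), p ω :=
    fun {p} => by
      rw [hμ, Measure.ae_ennreal_smul_measure_iff hscale, ← hι.map_comap, hι.ae_map_iff]
  have hpull : ∀ {p : Ω → Prop}, (∀ᵐ ω ∂m, p ω) → ∀ᵐ x ∂μ, p (ι x) :=
    fun h => hmap.2 (ae_restrict_of_ae h)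
  obtain ⟨F, hFm, hFsmul, hFf⟩ := exists_equivariant_extension hι hdom hf
  have hFι : ∀ᵐ x ∂μ, F (ι x) = f x := by
    filter_upwards [hpull hFf] with x hx using hx x rfl
  -- on `X`, the relation `g • ι x = (c g x)⁻¹ • ι (g • x)` turns `hfc` into invariance of `F`
  have hFinv : ∀ g ∈ M, ∀ᵐ ω ∂m, F (g • ω) = F ω := fun g hg => by
    refine ae_of_ae_restrict_fundamentalDomain hdom (hmap.1 ?_) fun h => ?_
    · filter_upwards [hcι g, hfc g hg, hFι, ae_smul_of_ae g hFι,
        hpull (ae_smul_of_ae g (ae_all_iff.2 hFsmul))] with x h₁ h₂ h₃ h₄ h₅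
      have := h₅ (c g x)
      rwa [← smul_comm g (c g x), ← h₁, h₄, h₂, smul_left_cancel_iff, ← h₃, eq_comm] at this
    · filter_upwards [hFsmul h, ae_smul_of_ae g (hFsmul h)] with ω h₁ h₂ h₃
      rwa [smul_comm, h₂, h₁, smul_left_cancel_iff] at h₃
  have hπ : Function.Surjective (QuotientGroup.mk' N) := QuotientGroup.mk'_surjective N
  have : Countable (H ⧸ N) := hπ.countable
  obtain ⟨B, hBm, hBsmul, hBne⟩ := exists_equivariant_finset hsmooth (QuotientGroup.mk' N) hstab
    m.toFinite hFm
  rw [ae_toFinite] at hBne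
  have hS : IsEquivariantFinset M (QuotientGroup.mk' N) m fun ω => B (F ω) := by
    refine ⟨hBm.comp hFm, hBne, fun h => ?_, fun g hg => ?_⟩
    · filter_upwards [hFsmul h] with ω hω
      rw [hω, hBsmul]
    · filter_upwards [hFinv g hg] with ω hω
      rw [hω]
  obtain ⟨T, hT, hcard⟩ := hm.exists_equivariant_singleton hIRS hπ hS
  obtain ⟨σ, hσ⟩ : ∃ σ : Finset (H ⧸ N) → H, ∀ k, QuotientGroup.mk' N (σ {k}) = k⁻¹ := by
    have : ∀ A : Finset (H ⧸ N), ∃ h : H, ∀ k, A = {k} → QuotientGroup.mk' N h = k⁻¹ := fun A => by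
      by_cases hA : ∃ k, A = {k}
      · obtain ⟨k, rfl⟩ := hA
        obtain ⟨h, hh⟩ := hπ k⁻¹
        exact ⟨h, fun k' hk' => by rw [hh, Finset.singleton_injective hk']⟩
      · exact ⟨1, fun k hk => absurd ⟨k, hk⟩ hA⟩
    choose σ hσ using this
    exact ⟨σ, fun k => hσ _ k rfl⟩
  refine ⟨fun x => σ (T (ι x)),
    (measurable_of_countable σ).comp (hT.measurable.comp hι.measurable), fun g hg => ?_⟩
  filter_upwards [hcι g, hpull hcard, hpull (ae_all_iff.2 hT.smul),
    hpull (ae_all_iff.2 fun h : H => ae_smul_of_ae h (hT.invariant g hg))] with x h₁ h₂ h₃ h₄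
  obtain ⟨a, ha⟩ := Finset.card_eq_one.1 h₂
  have hgx : T (ι (g • x)) = {QuotientGroup.mk' N (c g x) * a} := by
    rw [h₁, h₄, h₃, ha, Finset.smul_finset_singleton, smul_eq_mul]
  rw [← QuotientGroup.eq_one_iff]
  change QuotientGroup.mk' N _ = 1
  rw [map_mul, map_mul, map_inv, hgx, ha, hσ, hσ]
  group
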